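/- Theorem 3 (asymptotic capacity as $p_b\to\infty$). A base station (BS) with $M\ge 1$ antennas transmits to a single-antenna user with the help of an intelligent reflecting surface with $N\ge 0$ elements. The channel state is $\mathcal H=(\mathbf h_d,\mathbf G,\mathbf h_r,\Delta\boldsymbol\theta)$, a random element of $\mathbb C^M\times\mathbb C^{M\times N}\times\mathbb C^N\times\mathbb R^N$ with $\mathbf h_d\sim\mathcal{CN}(\mathbf 0,\beta_d\mathbf I)$, $\beta_d>0$, and an otherwise arbitrary joint distribution. The CSI $\mathcal H_b$ at the BS and $\mathcal H_u$ at the user are random elements with an arbitrary joint distribution with $\mathcal H$ that does not depend on $p_b$ (in particular $\mathcal H_b=\mathcal H_u=\mathcal H$, perfect CSI, is allowed). For phase shifts $\boldsymbol\theta\in[0,2\pi]^N$ the overall channel is $\hat{\mathbf h}=\mathbf h_d+\mathbf G\,\mathrm{diag}(e^{j(\theta_1+\Delta\theta_1)},\dots,e^{j(\theta_N+\Delta\theta_N)})\,\mathbf h_r$, and the user receives $$y=\hat{\mathbf h}^{\mathrm H}(\boldsymbol x+\boldsymbol\eta_b)+\eta_u+n,$$ where, for given $\hat{\mathbf h}$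 and a given law of $\boldsymbol x$, the variables $\boldsymbol x,\boldsymbol\eta_b,\eta_u,n$ are independent, $\boldsymbol\eta_b\sim\mathcal{CN}(\mathbf 0,\boldsymbol\Upsilon_B)$ with $\boldsymbol\Upsilon_B=\kappa_b\,\mathrm{diag}(\mathbb E\{\boldsymbol x\boldsymbol x^{\mathrm H}\})$, $\eta_u\sim\mathcal{CN}(0,v_u)$ with $v_u=\kappa_u\hat{\mathbf h}^{\mathrm H}(\mathbb E\{\boldsymbol x\boldsymbol x^{\mathrm H}\}+\boldsymbol\Upsilon_B)\hat{\mathbf h}$, and $n\sim\mathcal{CN}(0,\sigma_u^2)$, $\sigma_u>0$. Here $\kappa_b,\kappa_u\ge 0$ are the hardware impairment levels, not both zero. With transmission time $\tau_d\ge 0$ in a coherence period $\tau>0$, the downlink capacity at transmit power $p_b$ is $$C_d(p_b)=\frac{\tau_d}{\tau}\,\mathbb E\Big\{\max\ \mathcal I(\boldsymbol x;y\mid\mathcal H,\mathcal H_b,\mathcal H_u)\Big\},$$ where $\mathcal I$ is the conditional mutual information in bits and, for each realization of $\mathcal H_b$, the maximum (supremum) is taken jointly over the phase shifts $\boldsymbol\theta$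 and the conditional laws $f(\boldsymbol x\mid\mathcal H_b)$ with $\mathbb E\{\boldsymbol x^{\mathrm H}\boldsymbol x\}=p_b$, the mutual information being averaged over the conditional distribution of $(\mathcal H,\mathcal H_u)$ given $\mathcal H_b$. Then the limit $C_d(\infty)=\lim_{p_b\to\infty}C_d(p_b)$ exists, is finite, and satisfies $$\frac{\tau_d}{\tau}\log_2\!\Big(1+\frac{1}{\kappa_b+\kappa_u(1+\kappa_b)}\Big)\le C_d(\infty)\le\frac{\tau_d}{\tau}\log_2\!\Big(1+\frac{M}{\kappa_b+\kappa_u(M+\kappa_b)}\Big).$$ -/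

import Mathlib

open MeasureTheory ProbabilityTheory InformationTheory Filter Topology
open scoped ENNReal NNReal Matrix

noncomputable section

namespace IRSDownlink

/-- The circularly symmetric complex Gaussian law `CN(0, v)` on `ℂ`: real and imaginary parts are
independent real Gaussians with mean `0` and variance `v / 2`. -/
def complexGaussian (v : ℝ≥0) : Measure ℂ :=
  ((gaussianReal 0 (v / 2)).prod (gaussianReal 0 (v / 2))).map (fun z => (⟨z.1, z.2⟩ : ℂ))

/-- The law `CN(0, diag v)` on `ℂ^M`: independent coordinates `CN(0, v i)`. -/
def complexGaussianVec {M : ℕ} (v : Fin M → ℝ≥0) : Measure (Fin M → ℂ) :=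
  Measure.pi (fun i => complexGaussian (v i))

/-- An actual channel state `(h_d, G, h_r, Δθ)`: direct channel, BS-IRS channel, IRS-user channel,
and phase errors of the reflecting elements. -/
abbrev ChannelState (M N : ℕ) : Type :=
  (Fin M → ℂ) × (Fin M → Fin N → ℂ) × (Fin N → ℂ) × (Fin N → ℝ)

instance instStandardBorelSpaceChannelState {M N : ℕ} :
    StandardBorelSpace (ChannelState M N) := by
  have : StandardBorelSpace ((Fin N → ℂ) × (Fin N → ℝ)) := inferInstance
  have : StandardBorelSpace ((Fin M → Fin N → ℂ) × (Fin N → ℂ) × (Fin N → ℝ)) :=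
    StandardBorelSpace.prod
  exact StandardBorelSpace.prod

/-- The overall channel `h_d + G Φ̂ h_r` with `Φ̂ = diag (exp (j (θ_n + Δθ_n)))`. -/
def overallChannel {M N : ℕ} (s : ChannelState M N) (θ : Fin N → ℝ) : Fin M → ℂ :=
  s.1 + Matrix.of s.2.1 *ᵥ
    (Matrix.diagonal (fun n => Complex.exp (Complex.I * ((θ n + s.2.2.2 n : ℝ) : ℂ))) *ᵥ s.2.2.1)

/-- The matrix `E[x xᴴ]` for `x` of law `μ`. -/
def secondMoment {M : ℕ} (μ : Measure (Fin M → ℂ)) : Matrix (Fin M) (Fin M) ℂ :=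
  Matrix.of fun i j => ∫ x, x i * star (x j) ∂μ

/-- Covariance of the distortion noise at the BS, `Υ_B = κ_b diag (E[x xᴴ])`. -/
def bsDistortionCov {M : ℕ} (κb : ℝ) (μ : Measure (Fin M → ℂ)) : Matrix (Fin M) (Fin M) ℂ :=
  (κb : ℂ) • Matrix.diagonal (fun i => secondMoment μ i i)

/-- Variance of the distortion noise at the user when the overall channel is `h`,
`v_u = κ_u hᴴ (E[x xᴴ] + Υ_B) h`. -/
def userDistortionVar {M : ℕ} (κb κu : ℝ) (h : Fin M → ℂ) (μ : Measure (Fin M → ℂ)) : ℝ :=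
  κu * (star h ⬝ᵥ ((secondMoment μ + bsDistortionCov κb μ) *ᵥ h)).re

/-- Joint law of the independent noises `(η_b, η_u, n)` with `η_b ~ CN(0, Υ_B)`, `η_u ~ CN(0, v_u)`
and `n ~ CN(0, σ_u²)`. -/
def noiseLaw {M : ℕ} (κb κu σu : ℝ) (h : Fin M → ℂ) (μ : Measure (Fin M → ℂ)) :
    Measure ((Fin M → ℂ) × ℂ × ℂ) :=
  (complexGaussianVec fun i => (bsDistortionCov κb μ i i).re.toNNReal).prod
    ((complexGaussian (userDistortionVar κb κu h μ).toNNReal).prod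
      (complexGaussian (σu ^ 2).toNNReal))

/-- The received downlink signal `y = hᴴ (x + η_b) + η_u + n`. -/
def received {M : ℕ} (h x ηb : Fin M → ℂ) (ηu n : ℂ) : ℂ :=
  star h ⬝ᵥ (x + ηb) + ηu + n

/-- Joint law of `(x, y)` when the overall channel is `h`, the input `x` has law `μ`, and the noises
are independent of `x`. -/
def inputOutputLaw {M : ℕ} (κb κu σu : ℝ) (h : Fin M → ℂ) (μ : Measure (Fin M → ℂ)) :
    Measure ((Fin M → ℂ) × ℂ) :=
  (μ.prod (noiseLaw κb κu σu h μ)).map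
    (fun w => (w.1, received h w.1 w.2.1 w.2.2.1 w.2.2.2))

/-- The mutual information, in bits, of a pair of random variables with joint law `ρ`: the
Kullback-Leibler divergence of `ρ` from the product of its marginals. -/
def mutualInfo {α β : Type*} [MeasurableSpace α] [MeasurableSpace β] (ρ : Measure (α × β)) :
    ℝ≥0∞ :=
  klDiv ρ (ρ.fst.prod ρ.snd) / ENNReal.ofReal (Real.log 2)

/-- Admissible laws of the transmitted signal: `E[xᴴ x] = p`. -/
def IsInputLaw {M : ℕ} (p : ℝ) (μ : Measure (Fin M → ℂ)) : Prop :=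
  IsProbabilityMeasure μ ∧ ∫⁻ x, ∑ i, ‖x i‖ₑ ^ 2 ∂μ = ENNReal.ofReal p

/-- The downlink capacity `C_d = (τ_d / τ) E{ max I(x; y | H, H_b, H_u) }` at transmit power `p`.
For each realization `b` of the CSI `H_b` at the BS, the maximum is over the phase shifts
`θ ∈ [0, 2π]^N` and the law `μ = f(x | H_b = b)` of the transmitted signal. The mutual information is
averaged over the conditional distribution of the pair `(H, H_u)` given `H_b = b`. For given values
of `(H, H_b, H_u)` the pair `(x, y)` has law `inputOutputLaw`, because the noises do not depend on
the CSI at either end. -/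
def capacity {M N : ℕ} {Ω 𝓑 𝓤 : Type*} [MeasurableSpace Ω] [MeasurableSpace 𝓑]
    [MeasurableSpace 𝓤] [StandardBorelSpace 𝓤] [Nonempty 𝓤]
    (P : Measure Ω) [IsFiniteMeasure P]
    (H : Ω → ChannelState M N) (Hb : Ω → 𝓑) (Hu : Ω → 𝓤)
    (τd τ κb κu σu p : ℝ) : ℝ≥0∞ :=
  ENNReal.ofReal (τd / τ) *
    ∫⁻ b, (⨆ (θ : Fin N → ℝ) (_ : ∀ n, θ n ∈ Set.Icc 0 (2 * Real.pi))
        (μ : Measure (Fin M → ℂ)) (_ : IsInputLaw p μ),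
        ∫⁻ s, mutualInfo (inputOutputLaw κb κu σu (overallChannel s.1 θ) μ)
          ∂(condDistrib (fun ω => (H ω, Hu ω)) Hb P b)) ∂(P.map Hb)

end IRSDownlink

end

noncomputable section

namespace IRSDownlink

/-! Fix the channel `h` and the input law `μ`. Put S = E|hᴴx|² (`signalPower`) and T = ∑|h_i|²
E|x_i|² (`antennaPower`). All noises are independent Gaussians, so the user sees y = hᴴx + z with z
~ CN(0, D) and D = κ_b T + κ_u (S + κ_b T) + σ_u² (`inputOutputLaw_eq`). Distortion grows in
proportion to the signal, which is why the rate saturates.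

Upper bound: comparing with a Gaussian output of the same power gives I ≤ log₂(1 + S/D)
(`mutualInfo_inputOutputLaw_le`). Cauchy–Schwarz gives S ≤ M T, hence S/D ≤ M/(κ_b + κ_u(M + κ_b))
for every state, phase and input law.

Lower bound: a Gaussian signal on one antenna has S = T and a Gaussian output, so its rate is
explicit (`mutualInfo_singleAntennaLaw`). It tends to log₂(1 + 1/(κ_b + κ_u(1 + κ_b))) wherever that
antenna's overall gain is nonzero. The reflected path may be correlated with the direct one and
cancel it at a given phase, but almost never at a uniformly random common phase. The supremum over
phases dominates the average over that phase, and dominated convergence concludes.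

Existence of the limit: amplifying the input by r ≥ 1 multiplies signal and distortion powers by r²
but leaves the thermal noise fixed. The original channel is thus a degraded version of the amplified
one, and data processing makes the capacity monotone in the power (`mutualInfo_le_map_smul`). -/

/-! ### Complex Gaussian laws: density, characteristic function, moments. -/

lemma measurable_complexMk : Measurable (fun z : ℝ × ℝ => (⟨z.1, z.2⟩ : ℂ)) :=
  Complex.measurableEquivRealProd.symm.measurable

instance instIsProbabilityMeasureComplexGaussian (v : ℝ≥0) :
    IsProbabilityMeasure (complexGaussian v) :=
  Measure.isProbabilityMeasure_map measurable_complexMk.aemeasurable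

instance instIsProbabilityMeasureComplexGaussianVec {M : ℕ} (v : Fin M → ℝ≥0) :
    IsProbabilityMeasure (complexGaussianVec v) := by
  unfold complexGaussianVec; infer_instance

/-- The density of `CN(0, v)` with respect to Lebesgue measure on `ℂ`. -/
def complexGaussianPDF (v : ℝ≥0) (z : ℂ) : ℝ :=
  (Real.pi * v)⁻¹ * Real.exp (-‖z‖ ^ 2 / v)

@[fun_prop]
lemma measurable_complexGaussianPDF (v : ℝ≥0) : Measurable (complexGaussianPDF v) := by
  unfold complexGaussianPDF; fun_prop

lemma complexGaussianPDF_pos {v : ℝ≥0} (hv : v ≠ 0) (z : ℂ) : 0 < complexGaussianPDF v z := by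
  have : 0 < (v : ℝ) := by exact_mod_cast pos_iff_ne_zero.2 hv
  unfold complexGaussianPDF
  positivity

lemma gaussianPDFReal_mul_gaussianPDFReal {v : ℝ≥0} (hv : v ≠ 0) (x y : ℝ) :
    gaussianPDFReal 0 (v / 2) x * gaussianPDFReal 0 (v / 2) y = complexGaussianPDF v ⟨x, y⟩ := by
  have hv' : 0 < (v : ℝ) := by exact_mod_cast pos_iff_ne_zero.2 hv
  have h : (2 * Real.pi * ((v / 2 : ℝ≥0) : ℝ)) = Real.pi * v := by push_cast; ring
  rw [gaussianPDFReal, gaussianPDFReal, complexGaussianPDF, h, mul_mul_mul_comm, ← mul_inv,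
    Real.mul_self_sqrt (by positivity), ← Real.exp_add, ← Complex.normSq_eq_norm_sq,
    Complex.normSq_mk]
  congr 2
  push_cast
  field_simp
  ring

lemma complexGaussian_eq_withDensity {v : ℝ≥0} (hv : v ≠ 0) :
    complexGaussian v = volume.withDensity (fun z => ENNReal.ofReal (complexGaussianPDF v z)) := by
  have hv2 : v / 2 ≠ 0 := by simpa using hv
  refine Measure.ext_of_lintegral _ fun f hf => ?_
  have hf' : Measurable fun z : ℝ × ℝ => f ⟨z.1, z.2⟩ := hf.comp measurable_complexMk
  rw [complexGaussian, lintegral_map hf measurable_complexMk,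
    gaussianReal_of_var_ne_zero _ hv2,
    prod_withDensity (measurable_gaussianPDF _ _) (measurable_gaussianPDF _ _),
    lintegral_withDensity_eq_lintegral_mul _ (by fun_prop) hf',
    lintegral_withDensity_eq_lintegral_mul _ (by fun_prop) hf,
    ← (Complex.volume_preserving_equiv_real_prod.symm).lintegral_comp_emb
      Complex.measurableEquivRealProd.symm.measurableEmbedding]
  refine lintegral_congr fun z => ?_
  simp only [Pi.mul_apply, gaussianPDF]
  rw [← ENNReal.ofReal_mul (gaussianPDFReal_nonneg _ _ _), gaussianPDFReal_mul_gaussianPDFReal hv]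
  rfl

lemma charFun_complexGaussian (v : ℝ≥0) (t : ℂ) :
    charFun (complexGaussian v) t = Complex.exp (-(v * ‖t‖ ^ 2 / 4)) := by
  rw [charFun_apply, complexGaussian, integral_map measurable_complexMk.aemeasurable
    (by fun_prop)]
  have h : ∀ z : ℝ × ℝ, Complex.exp (((inner ℝ (⟨z.1, z.2⟩ : ℂ) t : ℝ) : ℂ) * Complex.I) =
      Complex.exp (t.re * z.1 * Complex.I) * Complex.exp (t.im * z.2 * Complex.I) := by
    intro z
    rw [← Complex.exp_add, Complex.inner]
    congr 1
    simp
    ring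
  simp_rw [h]
  rw [integral_prod_mul (fun x : ℝ => Complex.exp (t.re * x * Complex.I))
    (fun x : ℝ => Complex.exp (t.im * x * Complex.I)), ← charFun_apply_real,
    ← charFun_apply_real, charFun_gaussianReal, charFun_gaussianReal, ← Complex.exp_add]
  congr 1
  have : (‖t‖ : ℂ) ^ 2 = t.re ^ 2 + t.im ^ 2 := by
    rw [← Complex.ofReal_pow, ← Complex.normSq_eq_norm_sq, Complex.normSq_apply]
    push_cast; ring
  rw [this]
  push_cast
  ring

lemma map_re_complexGaussian (v : ℝ≥0) :
    (complexGaussian v).map Complex.re = gaussianReal 0 (v / 2) := by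
  rw [complexGaussian, Measure.map_map Complex.measurable_re measurable_complexMk]
  exact (Measure.fst_prod (μ := gaussianReal 0 (v / 2)) (ν := gaussianReal 0 (v / 2)))

lemma map_im_complexGaussian (v : ℝ≥0) :
    (complexGaussian v).map Complex.im = gaussianReal 0 (v / 2) := by
  rw [complexGaussian, Measure.map_map Complex.measurable_im measurable_complexMk]
  exact (Measure.snd_prod (μ := gaussianReal 0 (v / 2)) (ν := gaussianReal 0 (v / 2)))

lemma integrable_re_complexGaussian (v : ℝ≥0) : Integrable Complex.re (complexGaussian v) := by
  have := memLp_one_iff_integrable.1 (memLp_id_gaussianReal (μ := 0) (v := v / 2) 1)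
  rw [← map_re_complexGaussian] at this
  exact this.comp_measurable Complex.measurable_re

lemma integrable_im_complexGaussian (v : ℝ≥0) : Integrable Complex.im (complexGaussian v) := by
  have := memLp_one_iff_integrable.1 (memLp_id_gaussianReal (μ := 0) (v := v / 2) 1)
  rw [← map_im_complexGaussian] at this
  exact this.comp_measurable Complex.measurable_im

lemma integral_re_complexGaussian (v : ℝ≥0) : ∫ z, z.re ∂(complexGaussian v) = 0 := by
  have h := integral_id_gaussianReal (μ := 0) (v := v / 2)
  rwa [← map_re_complexGaussian, integral_map (by fun_prop) (by fun_prop)] at h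

lemma integral_im_complexGaussian (v : ℝ≥0) : ∫ z, z.im ∂(complexGaussian v) = 0 := by
  have h := integral_id_gaussianReal (μ := 0) (v := v / 2)
  rwa [← map_im_complexGaussian, integral_map (by fun_prop) (by fun_prop)] at h

lemma integrable_sq_gaussianReal (v : ℝ≥0) :
    Integrable (fun x : ℝ => x ^ 2) (gaussianReal 0 v) :=
  (memLp_id_gaussianReal (μ := 0) (v := v) 2).integrable_sq

lemma integral_sq_gaussianReal (v : ℝ≥0) : ∫ x, x ^ 2 ∂(gaussianReal 0 v) = v := by
  have h := variance_fun_id_gaussianReal (μ := 0) (v := v)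
  rwa [variance_of_integral_eq_zero (by fun_prop) (by simp [integral_id_gaussianReal])] at h

lemma norm_sq_eq_re_sq_add_im_sq (z : ℂ) : ‖z‖ ^ 2 = z.re ^ 2 + z.im ^ 2 := by
  rw [← Complex.normSq_eq_norm_sq, Complex.normSq_apply]; ring

lemma integrable_norm_sq_complexGaussian (v : ℝ≥0) :
    Integrable (fun z : ℂ => ‖z‖ ^ 2) (complexGaussian v) := by
  simp_rw [norm_sq_eq_re_sq_add_im_sq]
  have h := integrable_sq_gaussianReal (v / 2)
  have h1 := h
  have h2 := h
  rw [← map_re_complexGaussian] at h1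
  rw [← map_im_complexGaussian] at h2
  exact (h1.comp_measurable Complex.measurable_re).add (h2.comp_measurable Complex.measurable_im)

lemma integral_norm_sq_complexGaussian (v : ℝ≥0) :
    ∫ z, ‖z‖ ^ 2 ∂(complexGaussian v) = v := by
  simp_rw [norm_sq_eq_re_sq_add_im_sq]
  have h := integrable_sq_gaussianReal (v / 2)
  have e := integral_sq_gaussianReal (v / 2)
  have h1 := h
  have h2 := h
  have e1 := e
  have e2 := e
  rw [← map_re_complexGaussian] at h1
  rw [← map_im_complexGaussian] at h2
  rw [← map_re_complexGaussian, integral_map (by fun_prop) (by fun_prop)] at e1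
  rw [← map_im_complexGaussian, integral_map (by fun_prop) (by fun_prop)] at e2
  have h1' : Integrable (fun z : ℂ => z.re ^ 2) (complexGaussian v) :=
    h1.comp_measurable Complex.measurable_re
  have h2' : Integrable (fun z : ℂ => z.im ^ 2) (complexGaussian v) :=
    h2.comp_measurable Complex.measurable_im
  rw [integral_add h1' h2', e1, e2]
  push_cast
  ring

/-! ### Additive Gaussian channels and their divergence from a product law. -/

/-- The joint law of `(x, a x + z)` when `x ~ μ` and `z ~ CN(0, v)` are independent. -/
def additiveLaw {E : Type*} [MeasurableSpace E] (a : E → ℂ) (v : ℝ≥0) (μ : Measure E) :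
    Measure (E × ℂ) :=
  (μ.prod (complexGaussian v)).map (fun w => (w.1, a w.1 + w.2))

/-- The likelihood ratio of `additiveLaw a v μ` with respect to `μ.prod (CN(0, w))`. -/
def additiveLikelihood {E : Type*} (a : E → ℂ) (v w : ℝ≥0) (p : E × ℂ) : ℝ :=
  complexGaussianPDF v (p.2 - a p.1) / complexGaussianPDF w p.2

lemma log_additiveLikelihood {E : Type*} {a : E → ℂ} {v w : ℝ≥0} (hv : v ≠ 0) (hw : w ≠ 0) (x : E) (z : ℂ) :
    Real.log (additiveLikelihood a v w (x, a x + z)) =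
      Real.log (w / v) + ‖a x + z‖ ^ 2 / w - ‖z‖ ^ 2 / v := by
  have hv' : 0 < (v : ℝ) := by exact_mod_cast pos_iff_ne_zero.2 hv
  have hw' : 0 < (w : ℝ) := by exact_mod_cast pos_iff_ne_zero.2 hw
  have h : additiveLikelihood a v w (x, a x + z) =
      (w / v) * Real.exp (‖a x + z‖ ^ 2 / w - ‖z‖ ^ 2 / v) := by
    simp only [additiveLikelihood, add_sub_cancel_left, complexGaussianPDF, neg_div,
      Real.exp_sub, Real.exp_neg]
    field_simp
  rw [h, Real.log_mul (by positivity) (Real.exp_pos _).ne', Real.log_exp]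
  ring

section AdditiveLaw

variable {E : Type*} [MeasurableSpace E] {a : E → ℂ} {μ : Measure E}

lemma isProbabilityMeasure_additiveLaw [IsProbabilityMeasure μ] (ha : Measurable a) (v : ℝ≥0) :
    IsProbabilityMeasure (additiveLaw a v μ) :=
  Measure.isProbabilityMeasure_map (by fun_prop)

lemma fst_additiveLaw (ha : Measurable a) (v : ℝ≥0) : (additiveLaw a v μ).fst = μ := by
  rw [additiveLaw, Measure.fst, Measure.map_map measurable_fst (by fun_prop)]
  exact Measure.fst_prod

lemma snd_additiveLaw [SFinite μ] (ha : Measurable a) (v : ℝ≥0) :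
    (additiveLaw a v μ).snd = (μ.map a).conv (complexGaussian v) := by
  rw [additiveLaw, Measure.snd, Measure.map_map measurable_snd (by fun_prop), Measure.conv,
    ← Measure.map_id (μ := complexGaussian v), Measure.map_prod_map _ _ ha measurable_id,
    Measure.map_map (by fun_prop) (by fun_prop), Measure.map_id]
  rfl

/-- Only the noise needs a density: for each fixed input both conditional output laws are
nondegenerate Gaussians, so `μ` may be discrete or singular. -/
lemma additiveLaw_eq_withDensity [SFinite μ] (ha : Measurable a) {v w : ℝ≥0} (hv : v ≠ 0) (hw : w ≠ 0) :
    additiveLaw a v μ = (μ.prod (complexGaussian w)).withDensity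
      (fun p => ENNReal.ofReal (additiveLikelihood a v w p)) := by
  refine Measure.ext_of_lintegral _ fun f hf => ?_
  have hm : Measurable (additiveLikelihood a v w) := by unfold additiveLikelihood; fun_prop
  rw [additiveLaw, lintegral_map hf (by fun_prop), lintegral_prod _ (by fun_prop),
    lintegral_withDensity_eq_lintegral_mul _ (by fun_prop) hf, lintegral_prod _ (by fun_prop)]
  refine lintegral_congr fun x => ?_
  rw [complexGaussian_eq_withDensity hv, complexGaussian_eq_withDensity hw,
    lintegral_withDensity_eq_lintegral_mul _ (by fun_prop) (by fun_prop),
    lintegral_withDensity_eq_lintegral_mul _ (by fun_prop) (by fun_prop)]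
  -- Translation invariance of Lebesgue measure on `ℂ`: substitute y = a x + z.
  conv_rhs => rw [← lintegral_add_left_eq_self _ (a x)]
  refine lintegral_congr fun z => ?_
  have hz := complexGaussianPDF_pos hw (a x + z)
  simp only [Pi.mul_apply, additiveLikelihood, add_sub_cancel_left]
  rw [← mul_assoc, ← ENNReal.ofReal_mul hz.le, mul_div_cancel₀ _ hz.ne']

lemma integrable_norm_add_sq [IsProbabilityMeasure μ] (ha : Measurable a)
    (hi : Integrable (fun x => ‖a x‖ ^ 2) μ) (v : ℝ≥0) :
    Integrable (fun p : E × ℂ => ‖a p.1 + p.2‖ ^ 2) (μ.prod (complexGaussian v)) := by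
  have h1 : Integrable (fun p : E × ℂ => ‖a p.1‖ ^ 2) (μ.prod (complexGaussian v)) :=
    hi.comp_fst _
  have h2 : Integrable (fun p : E × ℂ => ‖p.2‖ ^ 2) (μ.prod (complexGaussian v)) :=
    (integrable_norm_sq_complexGaussian v).comp_snd _
  refine ((h1.add h2).const_mul 2).mono' (by fun_prop) (ae_of_all _ fun p => ?_)
  simp only [Pi.add_apply, norm_pow, norm_norm]
  have := norm_add_le (a p.1) p.2
  nlinarith [sq_nonneg (‖a p.1‖ - ‖p.2‖), norm_nonneg (a p.1 + p.2), norm_nonneg (a p.1),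
    norm_nonneg p.2]

lemma integral_norm_add_sq [IsProbabilityMeasure μ] (ha : Measurable a)
    (hi : Integrable (fun x => ‖a x‖ ^ 2) μ) (v : ℝ≥0) :
    ∫ p : E × ℂ, ‖a p.1 + p.2‖ ^ 2 ∂(μ.prod (complexGaussian v)) = ∫ x, ‖a x‖ ^ 2 ∂μ + v := by
  rw [integral_prod _ (integrable_norm_add_sq ha hi v)]
  have h : ∀ x, ∫ z, ‖a x + z‖ ^ 2 ∂(complexGaussian v) = ‖a x‖ ^ 2 + v := by
    intro x
    have e : ∀ z : ℂ, ‖a x + z‖ ^ 2 =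
        ‖a x‖ ^ 2 + (2 * (a x).re * z.re + 2 * (a x).im * z.im) + ‖z‖ ^ 2 := by
      intro z
      simp only [norm_sq_eq_re_sq_add_im_sq, Complex.add_re, Complex.add_im]
      ring
    have i1 := (integrable_re_complexGaussian v).const_mul (2 * (a x).re)
    have i2 := (integrable_im_complexGaussian v).const_mul (2 * (a x).im)
    have i3 : Integrable (fun z : ℂ => 2 * (a x).re * z.re + 2 * (a x).im * z.im)
      (complexGaussian v) := i1.add i2
    have i4 : Integrable (fun z : ℂ => ‖a x‖ ^ 2 + (2 * (a x).re * z.re + 2 * (a x).im * z.im))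
      (complexGaussian v) := (integrable_const _).add i3
    simp_rw [e]
    rw [integral_add i4 (integrable_norm_sq_complexGaussian v),
      integral_add (integrable_const _) i3, integral_add i1 i2, integral_const_mul,
      integral_const_mul, integral_re_complexGaussian, integral_im_complexGaussian,
      integral_norm_sq_complexGaussian]
    simp
  simp_rw [h]
  rw [integral_add hi (integrable_const _)]
  simp

/-- The divergence of the law of `(x, a x + z)` from the product law with Gaussian output of the same
power. -/
lemma klDiv_additiveLaw [IsProbabilityMeasure μ] (ha : Measurable a)
    (hi : Integrable (fun x => ‖a x‖ ^ 2) μ) {v w : ℝ≥0} (hv : v ≠ 0)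
    (hw : (w : ℝ) = ∫ x, ‖a x‖ ^ 2 ∂μ + v) :
    klDiv (additiveLaw a v μ) (μ.prod (complexGaussian w)) = ENNReal.ofReal (Real.log (w / v)) := by
  have hv' : 0 < (v : ℝ) := by exact_mod_cast pos_iff_ne_zero.2 hv
  have hw' : 0 < (w : ℝ) := by
    rw [hw]
    have : 0 ≤ ∫ x, ‖a x‖ ^ 2 ∂μ := integral_nonneg fun x => sq_nonneg _
    positivity
  have hw0 : w ≠ 0 := by rintro rfl; simp at hw'
  have hm : Measurable (additiveLikelihood a v w) := by unfold additiveLikelihood; fun_prop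
  have hP := isProbabilityMeasure_additiveLaw (μ := μ) ha v
  have hd := additiveLaw_eq_withDensity (μ := μ) ha hv hw0
  have hac : additiveLaw a v μ ≪ μ.prod (complexGaussian w) := by
    rw [hd]; exact withDensity_absolutelyContinuous _ _
  have hllr : llr (additiveLaw a v μ) (μ.prod (complexGaussian w)) =ᵐ[additiveLaw a v μ]
      fun p => Real.log (additiveLikelihood a v w p) := by
    have h : (additiveLaw a v μ).rnDeriv (μ.prod (complexGaussian w)) =ᵐ[μ.prod (complexGaussian w)]
        fun p => ENNReal.ofReal (additiveLikelihood a v w p) := by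
      rw [hd]
      exact Measure.rnDeriv_withDensity _ (by fun_prop)
    filter_upwards [hac.ae_le h] with p hp
    rw [llr, hp, ENNReal.toReal_ofReal]
    exact (div_pos (complexGaussianPDF_pos hv _) (complexGaussianPDF_pos hw0 _)).le
  have hz : Integrable (fun p : E × ℂ => ‖p.2‖ ^ 2) (μ.prod (complexGaussian v)) :=
    (integrable_norm_sq_complexGaussian v).comp_snd _
  have hint1 : Integrable (fun p : E × ℂ => Real.log (w / v) + ‖a p.1 + p.2‖ ^ 2 / w)
      (μ.prod (complexGaussian v)) :=
    (integrable_const _).add ((integrable_norm_add_sq ha hi v).div_const _)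
  have hlog : Integrable (fun p => Real.log (additiveLikelihood a v w p)) (additiveLaw a v μ) := by
    rw [additiveLaw, integrable_map_measure hm.log.aestronglyMeasurable (by fun_prop)]
    refine (hint1.sub (hz.div_const v)).congr (ae_of_all _ fun p => ?_)
    exact (log_additiveLikelihood hv hw0 p.1 p.2).symm
  rw [klDiv_of_ac_of_integrable hac (hlog.congr hllr.symm), integral_congr_ae hllr, probReal_univ,
    probReal_univ, additiveLaw,
    integral_map (by fun_prop) hm.log.aestronglyMeasurable]
  simp_rw [log_additiveLikelihood hv hw0]
  have hz' : ∫ p : E × ℂ, ‖p.2‖ ^ 2 ∂(μ.prod (complexGaussian v)) = v := by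
    rw [integral_fun_snd (fun z : ℂ => ‖z‖ ^ 2), integral_norm_sq_complexGaussian]
    simp
  -- The choice of `w` as the output power makes both quadratic terms average to 1, so they cancel
  -- and only the logarithm remains.
  rw [integral_sub hint1 (hz.div_const _),
    integral_add (integrable_const _) ((integrable_norm_add_sq ha hi v).div_const _),
    integral_div, integral_div, integral_norm_add_sq ha hi, hz', ← hw]
  simp [hv'.ne', hw'.ne']

end AdditiveLaw

/-- Replacing the second marginal by any other law does not decrease the divergence of a joint law
from a product law. -/
lemma klDiv_prod_marginals_le {α β : Type*} [MeasurableSpace α] [MeasurableSpace β]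
    [StandardBorelSpace α] [Nonempty α] (ρ : Measure (α × β)) [IsProbabilityMeasure ρ]
    (q : Measure β) [IsProbabilityMeasure q] :
    klDiv ρ (ρ.fst.prod ρ.snd) ≤ klDiv ρ (ρ.fst.prod q) := by
  -- The chain rule splits off the first coordinate, whereas the marginal to be replaced is the
  -- second. Swapping is invertible, so data processing in both directions preserves the divergence.
  have hswap : ∀ ν : Measure β, [IsProbabilityMeasure ν] →
      klDiv (ρ.map Prod.swap) (ν.prod ρ.fst) = klDiv ρ (ρ.fst.prod ν) := by
    intro ν _
    apply le_antisymm
    · rw [← Measure.prod_swap]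
      exact klDiv_map_le _ _ measurable_swap
    · have h := klDiv_map_le (ρ.map Prod.swap) (ν.prod ρ.fst) measurable_swap
      rwa [Measure.prod_swap, Measure.map_map measurable_swap measurable_swap,
        Prod.swap_swap_eq, Measure.map_id] at h
  have : IsProbabilityMeasure (ρ.map Prod.swap) :=
    Measure.isProbabilityMeasure_map measurable_swap.aemeasurable
  have hs : (ρ.map Prod.swap).fst = ρ.snd := Measure.fst_map_swap
  -- By the chain rule the right side equals the left side plus `klDiv ρ.snd q`.
  rw [← hswap, ← hswap, ← (ρ.map Prod.swap).disintegrate (ρ.map Prod.swap).condKernel, hs,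
    ← Measure.compProd_const, ← Measure.compProd_const, klDiv_compProd_eq_add (μ := ρ.snd) (ν := q)]
  exact le_add_self

/-! ### Sums and linear images of complex Gaussians, via characteristic functions. -/

lemma inner_mul_left_complex (c x t : ℂ) : inner ℝ (c * x) t = inner ℝ x (star c * t) := by
  simp [Complex.inner]
  ring

lemma exp_inner_dotProduct {M : ℕ} (h x : Fin M → ℂ) (t : ℂ) :
    Complex.exp ((inner ℝ (star h ⬝ᵥ x) t : ℝ) * Complex.I) =
      ∏ i, Complex.exp ((inner ℝ (x i) (h i * t) : ℝ) * Complex.I) := by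
  rw [dotProduct, sum_inner, ← Complex.exp_sum, ← Finset.sum_mul, Complex.ofReal_sum]
  simp_rw [Pi.star_apply, inner_mul_left_complex, star_star]

lemma conv_complexGaussian (v w : ℝ≥0) :
    (complexGaussian v).conv (complexGaussian w) = complexGaussian (v + w) := by
  refine Measure.ext_of_charFun (funext fun t => ?_)
  rw [charFun_conv]
  simp only [charFun_complexGaussian, ← Complex.exp_add]
  congr 1
  push_cast
  ring

lemma map_const_mul_complexGaussian (c : ℂ) (v : ℝ≥0) :
    (complexGaussian v).map (fun z => c * z) = complexGaussian (‖c‖₊ ^ 2 * v) := by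
  have : IsProbabilityMeasure ((complexGaussian v).map (fun z => c * z)) :=
    Measure.isProbabilityMeasure_map (by fun_prop)
  refine Measure.ext_of_charFun (funext fun t => ?_)
  rw [charFun_apply, integral_map (by fun_prop) (by fun_prop)]
  simp_rw [inner_mul_left_complex]
  rw [← charFun_apply]
  simp only [charFun_complexGaussian, norm_mul, norm_star]
  congr 1
  push_cast
  ring

lemma map_dotProduct_complexGaussianVec {M : ℕ} (h : Fin M → ℂ) (v : Fin M → ℝ≥0) :
    (complexGaussianVec v).map (fun x => star h ⬝ᵥ x) =
      complexGaussian (∑ i, ‖h i‖₊ ^ 2 * v i) := by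
  have hm : Measurable (fun x : Fin M → ℂ => star h ⬝ᵥ x) := by
    unfold dotProduct; fun_prop
  have : IsProbabilityMeasure ((complexGaussianVec v).map (fun x => star h ⬝ᵥ x)) :=
    Measure.isProbabilityMeasure_map hm.aemeasurable
  refine Measure.ext_of_charFun (funext fun t => ?_)
  rw [charFun_apply, integral_map hm.aemeasurable (by fun_prop)]
  simp_rw [exp_inner_dotProduct]
  rw [complexGaussianVec, integral_fintype_prod_eq_prod
    (f := fun i (z : ℂ) => Complex.exp ((inner ℝ z (h i * t) : ℝ) * Complex.I))]
  simp only [← charFun_apply, charFun_complexGaussian, norm_mul, ← Complex.exp_sum]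
  congr 1
  push_cast
  rw [Finset.sum_mul, Finset.sum_div, ← Finset.sum_neg_distrib]
  refine Finset.sum_congr rfl fun i _ => ?_
  ring

lemma map_noise_complexGaussian {M : ℕ} (h : Fin M → ℂ) (v : Fin M → ℝ≥0) (vu vn : ℝ≥0) :
    ((complexGaussianVec v).prod ((complexGaussian vu).prod (complexGaussian vn))).map
      (fun w => star h ⬝ᵥ w.1 + (w.2.1 + w.2.2)) =
      complexGaussian (∑ i, ‖h i‖₊ ^ 2 * v i + (vu + vn)) := by
  have hm : Measurable (fun x : Fin M → ℂ => star h ⬝ᵥ x) := by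
    unfold dotProduct; fun_prop
  rw [← conv_complexGaussian, ← map_dotProduct_complexGaussianVec, ← conv_complexGaussian,
    Measure.conv, Measure.conv, Measure.map_prod_map _ _ hm (by fun_prop),
    Measure.map_map (by fun_prop) (by fun_prop)]
  rfl

/-! ### Signal and noise powers; reduction to a scalar Gaussian channel. -/

/-- The received signal power `E |hᴴ x|²`. -/
def signalPower {M : ℕ} (h : Fin M → ℂ) (μ : Measure (Fin M → ℂ)) : ℝ :=
  ∫ x, ‖star h ⬝ᵥ x‖ ^ 2 ∂μ

/-- The total power `∑ i, |h i|² E |x i|²` received from the individual antennas. -/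
def antennaPower {M : ℕ} (h : Fin M → ℂ) (μ : Measure (Fin M → ℂ)) : ℝ :=
  ∑ i, ‖h i‖ ^ 2 * ∫ x, ‖x i‖ ^ 2 ∂μ

/-- The power of the received noise: distortion noises and thermal noise. -/
def noisePower {M : ℕ} (κb κu σu : ℝ) (h : Fin M → ℂ) (μ : Measure (Fin M → ℂ)) : ℝ :=
  κb * antennaPower h μ + κu * (signalPower h μ + κb * antennaPower h μ) + σu ^ 2

lemma signalPower_nonneg {M : ℕ} (h : Fin M → ℂ) (μ : Measure (Fin M → ℂ)) :
    0 ≤ signalPower h μ := integral_nonneg fun _ => sq_nonneg _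

lemma antennaPower_nonneg {M : ℕ} (h : Fin M → ℂ) (μ : Measure (Fin M → ℂ)) :
    0 ≤ antennaPower h μ :=
  Finset.sum_nonneg fun _ _ => mul_nonneg (sq_nonneg _) (integral_nonneg fun _ => sq_nonneg _)

lemma noisePower_pos {M : ℕ} {κb κu σu : ℝ} (hκb : 0 ≤ κb) (hκu : 0 ≤ κu) (hσu : 0 < σu)
    (h : Fin M → ℂ) (μ : Measure (Fin M → ℂ)) : 0 < noisePower κb κu σu h μ := by
  have := signalPower_nonneg h μ
  have := antennaPower_nonneg h μ
  unfold noisePower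
  positivity

lemma measurable_dotProduct_left {M : ℕ} (h : Fin M → ℂ) :
    Measurable (fun x : Fin M → ℂ => h ⬝ᵥ x) := by
  unfold dotProduct; fun_prop

lemma measurable_norm_apply_sq {M : ℕ} (i : Fin M) :
    Measurable (fun x : Fin M → ℂ => ‖x i‖ ^ 2) := by
  fun_prop

lemma IsInputLaw.integrable_norm_sq {M : ℕ} {p : ℝ} {μ : Measure (Fin M → ℂ)}
    (hμ : IsInputLaw p μ) (i : Fin M) : Integrable (fun x : Fin M → ℂ => ‖x i‖ ^ 2) μ := by
  refine ⟨(measurable_norm_apply_sq i).aestronglyMeasurable, ?_⟩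
  have h : ∫⁻ x, ‖(‖x i‖ ^ 2 : ℝ)‖ₑ ∂μ ≤ ∫⁻ x, ∑ i, ‖x i‖ₑ ^ 2 ∂μ := by
    refine lintegral_mono fun x => ?_
    rw [enorm_pow, enorm_norm]
    exact Finset.single_le_sum (f := fun i => ‖x i‖ₑ ^ 2) (fun _ _ => zero_le) (Finset.mem_univ i)
  exact (h.trans_eq hμ.2).trans_lt ENNReal.ofReal_lt_top

section Moments

variable {M : ℕ} {μ : Measure (Fin M → ℂ)}

lemma integrable_mul_star (hμ : ∀ i, Integrable (fun x : Fin M → ℂ => ‖x i‖ ^ 2) μ) (i j : Fin M) :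
    Integrable (fun x : Fin M → ℂ => x i * star (x j)) μ := by
  refine ((hμ i).add (hμ j)).mono' (by fun_prop) (ae_of_all _ fun x => ?_)
  simp only [norm_mul, norm_star, Pi.add_apply]
  nlinarith [sq_nonneg (‖x i‖ - ‖x j‖), sq_nonneg ‖x i‖, sq_nonneg ‖x j‖]

/-- Cauchy–Schwarz against the all-ones vector; this is the source of the factor M in the upper
bound. -/
lemma norm_dotProduct_sq_le (h x : Fin M → ℂ) :
    ‖h ⬝ᵥ x‖ ^ 2 ≤ M * ∑ i, ‖h i‖ ^ 2 * ‖x i‖ ^ 2 := by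
  calc ‖h ⬝ᵥ x‖ ^ 2 ≤ (∑ i, ‖h i * x i‖) ^ 2 := by
        gcongr
        exact norm_sum_le _ _
    _ ≤ M * ∑ i, ‖h i * x i‖ ^ 2 := by
        simpa using sq_sum_le_card_mul_sum_sq (s := Finset.univ) (f := fun i => ‖h i * x i‖)
    _ = M * ∑ i, ‖h i‖ ^ 2 * ‖x i‖ ^ 2 := by simp [mul_pow]

lemma integrable_sum_norm_sq (hμ : ∀ i, Integrable (fun x : Fin M → ℂ => ‖x i‖ ^ 2) μ)
    (h : Fin M → ℂ) : Integrable (fun x : Fin M → ℂ => ∑ i, ‖h i‖ ^ 2 * ‖x i‖ ^ 2) μ :=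
  integrable_finsetSum _ fun i _ => (hμ i).const_mul _

lemma integrable_norm_dotProduct_sq (hμ : ∀ i, Integrable (fun x : Fin M → ℂ => ‖x i‖ ^ 2) μ)
    (h : Fin M → ℂ) : Integrable (fun x : Fin M → ℂ => ‖star h ⬝ᵥ x‖ ^ 2) μ := by
  refine ((integrable_sum_norm_sq hμ h).const_mul M).mono'
    ((measurable_dotProduct_left _).norm.pow_const 2).aestronglyMeasurable
    (ae_of_all _ fun x => ?_)
  simpa using norm_dotProduct_sq_le (star h) x

lemma signalPower_le (hμ : ∀ i, Integrable (fun x : Fin M → ℂ => ‖x i‖ ^ 2) μ) (h : Fin M → ℂ) :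
    signalPower h μ ≤ M * antennaPower h μ := by
  have e : antennaPower h μ = ∫ x, ∑ i, ‖h i‖ ^ 2 * ‖x i‖ ^ 2 ∂μ := by
    rw [integral_finsetSum _ fun i _ => (hμ i).const_mul _]
    simp_rw [integral_const_mul, antennaPower]
  rw [e, ← integral_const_mul]
  refine integral_mono (integrable_norm_dotProduct_sq hμ h)
    ((integrable_sum_norm_sq hμ h).const_mul M) fun x => ?_
  simpa using norm_dotProduct_sq_le (star h) x

lemma secondMoment_diag (i : Fin M) :
    secondMoment μ i i = ((∫ x, ‖x i‖ ^ 2 ∂μ : ℝ) : ℂ) := by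
  rw [secondMoment, Matrix.of_apply, ← integral_complex_ofReal]
  refine integral_congr_ae (ae_of_all _ fun x => ?_)
  simp [Complex.mul_conj, Complex.normSq_eq_norm_sq]

lemma star_dotProduct_secondMoment (hμ : ∀ i, Integrable (fun x : Fin M → ℂ => ‖x i‖ ^ 2) μ)
    (h : Fin M → ℂ) :
    star h ⬝ᵥ (secondMoment μ *ᵥ h) = (signalPower h μ : ℂ) := by
  have e : ∀ x : Fin M → ℂ, ((‖star h ⬝ᵥ x‖ ^ 2 : ℝ) : ℂ) =
      ∑ i, ∑ j, star (h i) * (x i * star (x j) * h j) := by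
    intro x
    rw [← Complex.normSq_eq_norm_sq, ← Complex.mul_conj, dotProduct, map_sum,
      Finset.sum_mul_sum]
    refine Finset.sum_congr rfl fun i _ => Finset.sum_congr rfl fun j _ => ?_
    simp
    ring
  rw [signalPower, ← integral_complex_ofReal]
  simp_rw [e]
  have hi : ∀ i j, Integrable (fun x : Fin M → ℂ => star (h i) * (x i * star (x j) * h j)) μ :=
    fun i j => ((integrable_mul_star hμ i j).mul_const _).const_mul _
  rw [integral_finsetSum _ fun i _ => integrable_finsetSum _ fun j _ => hi i j]
  simp_rw [integral_finsetSum _ fun j _ => hi _ j, integral_const_mul, integral_mul_const,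
    dotProduct, Matrix.mulVec, dotProduct, secondMoment, Matrix.of_apply, Finset.mul_sum]
  rfl

lemma star_dotProduct_bsDistortionCov (κb : ℝ) (h : Fin M → ℂ) :
    star h ⬝ᵥ (bsDistortionCov κb μ *ᵥ h) = ((κb * antennaPower h μ : ℝ) : ℂ) := by
  rw [bsDistortionCov, Matrix.smul_mulVec, dotProduct_smul, antennaPower]
  simp only [dotProduct, Matrix.mulVec_diagonal, secondMoment_diag, smul_eq_mul]
  push_cast
  congr 1
  refine Finset.sum_congr rfl fun i _ => ?_
  rw [← Complex.ofReal_pow, ← Complex.normSq_eq_norm_sq, ← Complex.mul_conj]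
  simp
  ring

lemma userDistortionVar_eq (hμ : ∀ i, Integrable (fun x : Fin M → ℂ => ‖x i‖ ^ 2) μ) (κb κu : ℝ)
    (h : Fin M → ℂ) :
    userDistortionVar κb κu h μ = κu * (signalPower h μ + κb * antennaPower h μ) := by
  rw [userDistortionVar, Matrix.add_mulVec, dotProduct_add, star_dotProduct_secondMoment hμ,
    star_dotProduct_bsDistortionCov]
  simp

lemma bsDistortionCov_diag (κb : ℝ) (i : Fin M) :
    (bsDistortionCov κb μ i i).re = κb * ∫ x, ‖x i‖ ^ 2 ∂μ := by
  simp [bsDistortionCov, secondMoment_diag]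

/-- Projecting the antenna distortions on `h` and adding the other two independent Gaussians yields
one Gaussian of variance `noisePower`; the three-noise model is not needed after this. -/
lemma inputOutputLaw_eq [IsProbabilityMeasure μ]
    (hμ : ∀ i, Integrable (fun x : Fin M → ℂ => ‖x i‖ ^ 2) μ) {κb κu : ℝ} (hκb : 0 ≤ κb)
    (hκu : 0 ≤ κu) (σu : ℝ) (h : Fin M → ℂ) :
    inputOutputLaw κb κu σu h μ =
      additiveLaw (fun x => star h ⬝ᵥ x) (noisePower κb κu σu h μ).toNNReal μ := by
  have hm := measurable_dotProduct_left (star h)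
  have hS := signalPower_nonneg h μ
  have hT := antennaPower_nonneg h μ
  have hv : (noisePower κb κu σu h μ).toNNReal =
      ∑ i, ‖h i‖₊ ^ 2 * (bsDistortionCov κb μ i i).re.toNNReal +
        ((userDistortionVar κb κu h μ).toNNReal + (σu ^ 2).toNNReal) := by
    have hi : ∀ i, 0 ≤ ∫ x, ‖x i‖ ^ 2 ∂μ := fun i => integral_nonneg fun _ => sq_nonneg _
    rw [userDistortionVar_eq hμ]
    simp_rw [bsDistortionCov_diag]
    rw [← NNReal.coe_inj]
    push_cast
    rw [Real.coe_toNNReal _ (by unfold noisePower; positivity), Real.coe_toNNReal _ (by positivity),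
      Real.coe_toNNReal _ (by positivity), noisePower, add_assoc]
    congr 1
    rw [antennaPower, Finset.mul_sum]
    refine Finset.sum_congr rfl fun i _ => ?_
    rw [Real.coe_toNNReal _ (mul_nonneg hκb (hi i))]
    ring
  have hmn : Measurable (fun w : (Fin M → ℂ) × ℂ × ℂ => star h ⬝ᵥ w.1 + (w.2.1 + w.2.2)) := by
    fun_prop
  rw [additiveLaw, hv, ← map_noise_complexGaussian, inputOutputLaw, ← noiseLaw]
  have hn : IsProbabilityMeasure (noiseLaw κb κu σu h μ) := by unfold noiseLaw; infer_instance
  have hp := Measure.map_prod_map μ (noiseLaw κb κu σu h μ) measurable_id hmn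
  rw [Measure.map_id] at hp
  rw [hp, Measure.map_map (by fun_prop) (by fun_prop)]
  congr 1
  ext w
  · rfl
  · simp [received, dotProduct_add]
    ring

end Moments

/-! ### Data processing, the Gaussian upper bound, and scaling of the input. -/

/-- Data processing inequality: mutual information does not increase when the first variable is
mapped and the second one is mapped together with independent noise. -/
lemma mutualInfo_map_le {α β γ α' β' : Type*} [MeasurableSpace α] [MeasurableSpace β]
    [MeasurableSpace γ] [MeasurableSpace α'] [MeasurableSpace β'] (ρ : Measure (α × β))
    [IsProbabilityMeasure ρ] (ν : Measure γ) [IsProbabilityMeasure ν] {f : α → α'}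
    (hf : Measurable f) {g : β × γ → β'} (hg : Measurable g) :
    mutualInfo ((ρ.prod ν).map (fun p => (f p.1.1, g (p.1.2, p.2)))) ≤ mutualInfo ρ := by
  have hF : Measurable (fun p : (α × β) × γ => (f p.1.1, g (p.1.2, p.2))) := by fun_prop
  have h1 : ((ρ.prod ν).map (fun p => (f p.1.1, g (p.1.2, p.2)))).fst = ρ.fst.map f := by
    have h : ((ρ.prod ν).map Prod.fst).map (f ∘ Prod.fst) = (ρ.map Prod.fst).map f := by
      rw [← Measure.fst, Measure.fst_prod, Measure.map_map hf measurable_fst]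
    rw [Measure.fst, Measure.map_map measurable_fst hF, Measure.fst, ← h,
      Measure.map_map (by fun_prop) measurable_fst]
    rfl
  have h2 : ((ρ.prod ν).map (fun p => (f p.1.1, g (p.1.2, p.2)))).snd =
      (ρ.snd.prod ν).map g := by
    rw [Measure.snd, Measure.map_map measurable_snd hF, Measure.snd]
    conv_rhs => rw [← Measure.map_id (μ := ν)]
    rw [Measure.map_prod_map _ _ measurable_snd measurable_id,
      Measure.map_map hg (by fun_prop)]
    rfl
  have h3 : (ρ.fst.map f).prod ((ρ.snd.prod ν).map g) =
      ((ρ.fst.prod ρ.snd).prod ν).map (fun p => (f p.1.1, g (p.1.2, p.2))) := by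
    rw [Measure.map_prod_map _ _ hf hg, ← Measure.prodAssoc_prod,
      Measure.map_map (by fun_prop) (by fun_prop)]
    rfl
  unfold mutualInfo
  gcongr
  rw [h1, h2, h3]
  -- Joint law and product of marginals are images under the same map; adjoining the same
  -- independent noise `ν` to both leaves the divergence unchanged.
  refine (klDiv_map_le _ _ hF).trans_eq ?_
  rw [← Measure.compProd_const, ← Measure.compProd_const, klDiv_compProd_left]

section Channel

variable {M : ℕ} {μ : Measure (Fin M → ℂ)}

/-- Replacing the true output marginal by CN(0, S + D) can only increase the divergence, and with
this marginal it is computed exactly, whatever the law of the input. -/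
lemma mutualInfo_inputOutputLaw_le [IsProbabilityMeasure μ]
    (hμ : ∀ i, Integrable (fun x : Fin M → ℂ => ‖x i‖ ^ 2) μ)
    {κb κu σu : ℝ} (hκb : 0 ≤ κb) (hκu : 0 ≤ κu) (hσu : 0 < σu) (h : Fin M → ℂ) :
    mutualInfo (inputOutputLaw κb κu σu h μ) ≤
      ENNReal.ofReal (Real.logb 2 (1 + signalPower h μ / noisePower κb κu σu h μ)) := by
  have hm := measurable_dotProduct_left (star h)
  have hD := noisePower_pos hκb hκu hσu h μ
  have hS := signalPower_nonneg h μ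
  have hD0 : (noisePower κb κu σu h μ).toNNReal ≠ 0 := by simpa using hD
  have hP := isProbabilityMeasure_additiveLaw (μ := μ) hm (noisePower κb κu σu h μ).toNNReal
  rw [inputOutputLaw_eq hμ hκb hκu, mutualInfo, Real.logb,
    ENNReal.ofReal_div_of_pos (Real.log_pos one_lt_two)]
  gcongr
  refine (klDiv_prod_marginals_le _
    (complexGaussian (signalPower h μ + noisePower κb κu σu h μ).toNNReal)).trans_eq ?_
  rw [fst_additiveLaw hm, klDiv_additiveLaw hm (integrable_norm_dotProduct_sq hμ h) hD0]
  · rw [Real.coe_toNNReal _ (by positivity), Real.coe_toNNReal _ hD.le, add_div, div_self hD.ne',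
      add_comm]
  · rw [Real.coe_toNNReal _ (by positivity), Real.coe_toNNReal _ hD.le]
    rfl

lemma signalPower_map_smul (r : ℝ) (h : Fin M → ℂ) :
    signalPower h (μ.map (fun x => r • x)) = r ^ 2 * signalPower h μ := by
  rw [signalPower, integral_map (by fun_prop)
    ((measurable_dotProduct_left _).norm.pow_const 2).aestronglyMeasurable, signalPower,
    ← integral_const_mul]
  simp [mul_pow]

lemma antennaPower_map_smul (r : ℝ) (h : Fin M → ℂ) :
    antennaPower h (μ.map (fun x => r • x)) = r ^ 2 * antennaPower h μ := by
  simp_rw [antennaPower, Finset.mul_sum]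
  refine Finset.sum_congr rfl fun i _ => ?_
  rw [integral_map (by fun_prop) (measurable_norm_apply_sq i).aestronglyMeasurable]
  simp_rw [Pi.smul_apply, norm_smul, mul_pow]
  rw [integral_const_mul]
  simp
  ring

/-- Scaling up the input does not decrease the mutual information. -/
lemma mutualInfo_le_map_smul [IsProbabilityMeasure μ]
    (hμ : ∀ i, Integrable (fun x : Fin M → ℂ => ‖x i‖ ^ 2) μ)
    {κb κu σu : ℝ} (hκb : 0 ≤ κb) (hκu : 0 ≤ κu) (hσu : 0 < σu) (h : Fin M → ℂ) {r : ℝ}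
    (hr : 1 ≤ r) :
    mutualInfo (inputOutputLaw κb κu σu h μ) ≤
      mutualInfo (inputOutputLaw κb κu σu h (μ.map (fun x => r • x))) := by
  have hr0 : r ≠ 0 := by positivity
  have hm := measurable_dotProduct_left (star h)
  have hP : IsProbabilityMeasure (μ.map (fun x => r • x)) :=
    Measure.isProbabilityMeasure_map (by fun_prop)
  have hμ' : ∀ i, Integrable (fun x : Fin M → ℂ => ‖x i‖ ^ 2) (μ.map (fun x => r • x)) := by
    intro i
    rw [integrable_map_measure (measurable_norm_apply_sq i).aestronglyMeasurable (by fun_prop)]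
    refine ((hμ i).const_mul (r ^ 2)).congr (ae_of_all _ fun x => ?_)
    simp [mul_pow]
  have hD := noisePower_pos hκb hκu hσu h μ
  have hD' := noisePower_pos hκb hκu hσu h (μ.map (fun x => r • x))
  -- Only the thermal term fails to scale by r², and r ≥ 1.
  have hle : noisePower κb κu σu h (μ.map (fun x => r • x)) ≤ r ^ 2 * noisePower κb κu σu h μ := by
    simp only [noisePower, signalPower_map_smul, antennaPower_map_smul]
    nlinarith [sq_nonneg σu, mul_nonneg (sub_nonneg.2 (one_le_pow₀ hr : 1 ≤ r ^ 2)) (sq_nonneg σu)]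
  rw [inputOutputLaw_eq hμ hκb hκu, inputOutputLaw_eq hμ' hκb hκu]
  set v := (noisePower κb κu σu h μ).toNNReal with hv
  set v' := (noisePower κb κu σu h (μ.map (fun x => r • x))).toNNReal with hv'
  -- `u` is the variance missing after the amplified output is divided by r: adding CN(0, u)
  -- restores the noise level of the original channel.
  obtain ⟨u, hu⟩ : ∃ u : ℝ≥0, v = ‖(r : ℂ)⁻¹‖₊ ^ 2 * v' + u := by
    refine exists_add_of_le ?_
    rw [← NNReal.coe_le_coe]
    push_cast
    rw [hv, hv', Real.coe_toNNReal _ hD.le, Real.coe_toNNReal _ hD'.le, norm_inv, inv_pow,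
      Complex.norm_real, Real.norm_eq_abs, sq_abs, inv_mul_le_iff₀ (by positivity)]
    exact hle
  have hPA := isProbabilityMeasure_additiveLaw (μ := μ.map (fun x => r • x)) hm v'
  have key := mutualInfo_map_le (additiveLaw (fun x => star h ⬝ᵥ x) v' (μ.map (fun x => r • x)))
    (complexGaussian u) (f := fun x => r⁻¹ • x) (by fun_prop)
    (g := fun p => (r : ℂ)⁻¹ * p.1 + p.2) (by fun_prop)
  convert key using 2
  have e1 := Measure.map_prod_map μ (complexGaussian v') (f := fun x => r • x) (g := id)
    (by fun_prop) measurable_id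
  have e3 := Measure.map_prod_map (complexGaussian v') (complexGaussian u)
    (f := fun z => (r : ℂ)⁻¹ * z) (g := id) (by fun_prop) measurable_id
  have hA : additiveLaw (fun x => star h ⬝ᵥ x) v' (μ.map (fun x => r • x)) =
      (μ.prod (complexGaussian v')).map (fun w => (r • w.1, star h ⬝ᵥ (r • w.1) + w.2)) := by
    rw [Measure.map_id] at e1
    rw [additiveLaw, e1, Measure.map_map (by fun_prop) (by fun_prop)]
    rfl
  have hB : (additiveLaw (fun x => star h ⬝ᵥ x) v' (μ.map (fun x => r • x))).prod
      (complexGaussian u) = ((μ.prod (complexGaussian v')).prod (complexGaussian u)).map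
        (Prod.map (fun w => (r • w.1, star h ⬝ᵥ (r • w.1) + w.2)) id) := by
    rw [hA, ← Measure.map_prod_map _ _ (by fun_prop) measurable_id, Measure.map_id]
  have hC : complexGaussian v = ((complexGaussian v').prod (complexGaussian u)).map
      (fun p => (r : ℂ)⁻¹ * p.1 + p.2) := by
    rw [Measure.map_id] at e3
    rw [hu, ← conv_complexGaussian, ← map_const_mul_complexGaussian, Measure.conv, e3,
      Measure.map_map (by fun_prop) (by fun_prop)]
    rfl
  have hD : μ.prod (complexGaussian v) =
      (μ.prod ((complexGaussian v').prod (complexGaussian u))).map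
        (Prod.map id (fun p => (r : ℂ)⁻¹ * p.1 + p.2)) := by
    rw [hC, ← Measure.map_prod_map _ _ measurable_id (by fun_prop), Measure.map_id]
  rw [hB, Measure.map_map (by fun_prop) (by fun_prop), additiveLaw, hD, ← Measure.prodAssoc_prod,
    Measure.map_map (by fun_prop) (by fun_prop), Measure.map_map (by fun_prop) (by fun_prop)]
  congr 1
  funext ⟨⟨x, z⟩, n⟩
  change (x, star h ⬝ᵥ x + ((r : ℂ)⁻¹ * z + n)) =
    (r⁻¹ • r • x, (r : ℂ)⁻¹ * (star h ⬝ᵥ (r • x) + z) + n)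
  refine Prod.ext ?_ ?_
  · simp [hr0]
  · simp [hr0, mul_add, add_assoc]

end Channel

/-! ### Gaussian signalling from a single antenna. -/

/-- The law of a Gaussian signal of power `p` sent from antenna `i` only. -/
def singleAntennaLaw {M : ℕ} (i : Fin M) (p : ℝ≥0) : Measure (Fin M → ℂ) :=
  (complexGaussian p).map (fun z => Pi.single i z)

section SingleAntenna

variable {M : ℕ} (i : Fin M) (p : ℝ≥0)

lemma measurable_single : Measurable (fun z : ℂ => (Pi.single i z : Fin M → ℂ)) :=
  (continuous_single (A := fun _ : Fin M => ℂ) i).measurable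

instance instIsProbabilityMeasureSingleAntennaLaw :
    IsProbabilityMeasure (singleAntennaLaw i p) :=
  Measure.isProbabilityMeasure_map (measurable_single i).aemeasurable

lemma isInputLaw_singleAntennaLaw : IsInputLaw p (singleAntennaLaw i p) := by
  refine ⟨inferInstance, ?_⟩
  rw [singleAntennaLaw, lintegral_map (by fun_prop) (measurable_single i)]
  have h : ∀ z : ℂ, ∑ j, ‖(Pi.single i z : Fin M → ℂ) j‖ₑ ^ 2 = ENNReal.ofReal (‖z‖ ^ 2) := by
    intro z
    rw [Finset.sum_eq_single i (fun j _ hj => by simp [hj]) (by simp), Pi.single_eq_same,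
      ENNReal.ofReal_pow (norm_nonneg z), ofReal_norm]
  simp_rw [h]
  rw [← ofReal_integral_eq_lintegral_ofReal (integrable_norm_sq_complexGaussian p)
    (ae_of_all _ fun z => sq_nonneg _), integral_norm_sq_complexGaussian]

lemma signalPower_singleAntennaLaw (h : Fin M → ℂ) :
    signalPower h (singleAntennaLaw i p) = ‖h i‖ ^ 2 * p := by
  rw [signalPower, singleAntennaLaw, integral_map (measurable_single i).aemeasurable
    ((measurable_dotProduct_left _).norm.pow_const 2).aestronglyMeasurable]
  simp_rw [dotProduct_single, norm_mul, mul_pow]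
  rw [integral_const_mul, integral_norm_sq_complexGaussian]
  simp

lemma antennaPower_singleAntennaLaw (h : Fin M → ℂ) :
    antennaPower h (singleAntennaLaw i p) = ‖h i‖ ^ 2 * p := by
  rw [antennaPower, Finset.sum_eq_single i]
  · rw [singleAntennaLaw, integral_map (measurable_single i).aemeasurable
      (measurable_norm_apply_sq i).aestronglyMeasurable]
    simp [integral_norm_sq_complexGaussian]
  · intro j _ hj
    rw [singleAntennaLaw, integral_map (measurable_single i).aemeasurable
      (measurable_norm_apply_sq j).aestronglyMeasurable]
    simp [hj]
  · simp

/-- A Gaussian input makes the output exactly Gaussian, so the comparison used for the upper bound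
is an equality here. With one active antenna S = T, which merges the distortions into the single
coefficient κ_b + κ_u(1 + κ_b). -/
lemma mutualInfo_singleAntennaLaw {κb κu σu : ℝ} (hκb : 0 ≤ κb) (hκu : 0 ≤ κu) (hσu : 0 < σu)
    (h : Fin M → ℂ) :
    mutualInfo (inputOutputLaw κb κu σu h (singleAntennaLaw i p)) =
      ENNReal.ofReal (Real.logb 2 (1 + ‖h i‖ ^ 2 * p /
        ((κb + κu * (1 + κb)) * (‖h i‖ ^ 2 * p) + σu ^ 2))) := by
  have hm := measurable_dotProduct_left (star h)
  have hμ := (isInputLaw_singleAntennaLaw i p).integrable_norm_sq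
  have hD := noisePower_pos hκb hκu hσu h (singleAntennaLaw i p)
  have hD0 : (noisePower κb κu σu h (singleAntennaLaw i p)).toNNReal ≠ 0 := by simpa using hD
  have hDe : noisePower κb κu σu h (singleAntennaLaw i p) =
      (κb + κu * (1 + κb)) * (‖h i‖ ^ 2 * p) + σu ^ 2 := by
    rw [noisePower, signalPower_singleAntennaLaw, antennaPower_singleAntennaLaw]
    ring
  have hmap : (singleAntennaLaw i p).map (fun x => star h ⬝ᵥ x) =
      complexGaussian (‖h i‖₊ ^ 2 * p) := by
    rw [singleAntennaLaw, Measure.map_map hm (measurable_single i), ← nnnorm_star (h i),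
      ← map_const_mul_complexGaussian]
    congr 1
    ext z
    simp
  rw [inputOutputLaw_eq hμ hκb hκu, mutualInfo, fst_additiveLaw hm, snd_additiveLaw hm, hmap,
    conv_complexGaussian, klDiv_additiveLaw hm (integrable_norm_dotProduct_sq hμ h) hD0,
    Real.logb, ENNReal.ofReal_div_of_pos (Real.log_pos one_lt_two)]
  · push_cast
    rw [Real.coe_toNNReal _ hD.le, add_div, div_self hD.ne', add_comm, hDe]
  · push_cast
    rw [Real.coe_toNNReal _ hD.le, ← signalPower_singleAntennaLaw i p h]
    rfl

end SingleAntenna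

/-! ### The bound that is uniform in the channel and the input. -/

/-- Drop σ_u² and insert T ≥ S/M into the noise power; the ratio is then independent of S. -/
lemma signalPower_div_noisePower_le {M : ℕ} (hM : 1 ≤ M) {μ : Measure (Fin M → ℂ)}
    (hμ : ∀ i, Integrable (fun x : Fin M → ℂ => ‖x i‖ ^ 2) μ) {κb κu σu : ℝ} (hκb : 0 ≤ κb)
    (hκu : 0 ≤ κu) (hκ : 0 < κb + κu) (hσu : 0 < σu) (h : Fin M → ℂ) :
    signalPower h μ / noisePower κb κu σu h μ ≤ M / (κb + κu * (M + κb)) := by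
  have hM' : (1 : ℝ) ≤ M := by exact_mod_cast hM
  have hD := noisePower_pos hκb hκu hσu h μ
  have hle := signalPower_le hμ h
  have hc : 0 < κb + κu * (M + κb) := by
    nlinarith [mul_nonneg hκu (sub_nonneg.2 hM'), mul_nonneg hκu hκb]
  rw [div_le_div_iff₀ hD hc, noisePower]
  nlinarith [mul_le_mul_of_nonneg_left hle hκb,
    mul_le_mul_of_nonneg_left hle (mul_nonneg hκu hκb), sq_nonneg σu,
    mul_nonneg (zero_le_one.trans hM') (sq_nonneg σu)]

lemma mutualInfo_inputOutputLaw_le_of_power {M : ℕ} (hM : 1 ≤ M) {μ : Measure (Fin M → ℂ)} {p : ℝ}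
    (hμ : IsInputLaw p μ) {κb κu σu : ℝ} (hκb : 0 ≤ κb)
    (hκu : 0 ≤ κu) (hκ : 0 < κb + κu) (hσu : 0 < σu) (h : Fin M → ℂ) :
    mutualInfo (inputOutputLaw κb κu σu h μ) ≤
      ENNReal.ofReal (Real.logb 2 (1 + M / (κb + κu * (M + κb)))) := by
  have := hμ.1
  refine (mutualInfo_inputOutputLaw_le hμ.integrable_norm_sq hκb hκu hσu h).trans ?_
  have hS := signalPower_nonneg h μ
  have hD := noisePower_pos hκb hκu hσu h μ
  gcongr 2
  · norm_num
  · gcongr 1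
    exact signalPower_div_noisePower_le hM hμ.integrable_norm_sq hκb hκu hκ hσu h

lemma IsInputLaw.map_smul {M : ℕ} {p : ℝ} {μ : Measure (Fin M → ℂ)} (hμ : IsInputLaw p μ) (r : ℝ) :
    IsInputLaw (r ^ 2 * p) (μ.map (fun x => r • x)) := by
  have := hμ.1
  refine ⟨Measure.isProbabilityMeasure_map (by fun_prop), ?_⟩
  rw [lintegral_map (by fun_prop) (by fun_prop)]
  simp_rw [Pi.smul_apply, enorm_smul, mul_pow, ← Finset.mul_sum]
  rw [lintegral_const_mul _ (by fun_prop), hμ.2, ENNReal.ofReal_mul (sq_nonneg r),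
    ← sq_abs r, ENNReal.ofReal_pow (abs_nonneg r), Real.enorm_eq_ofReal_abs]

/-! ### Almost sure nonvanishing of the channel, and the limit of the scalar rate. -/

lemma ae_complexGaussian_ne_zero {v : ℝ≥0} (hv : v ≠ 0) : ∀ᵐ z ∂(complexGaussian v), z ≠ 0 := by
  rw [complexGaussian_eq_withDensity hv]
  refine (withDensity_absolutelyContinuous _ _).ae_le ?_
  exact measure_eq_zero_iff_ae_notMem.1 (measure_singleton (0 : ℂ))

lemma ae_direct_ne_zero {M N : ℕ} {Ω : Type*} [MeasurableSpace Ω] {P : Measure Ω}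
    {H : Ω → ChannelState M N} (hH : Measurable H) {βd : ℝ≥0} (hβd : 0 < βd)
    (hd : P.map (fun ω => (H ω).1) = complexGaussianVec (fun _ => βd)) (i : Fin M) :
    ∀ᵐ ω ∂P, (H ω).1 i ≠ 0 := by
  have hm : Measurable (fun ω => (H ω).1) := by fun_prop
  have h1 : ∀ᵐ x ∂(complexGaussianVec (M := M) fun _ => βd), x i ≠ 0 :=
    (measurePreserving_eval (fun _ : Fin M => complexGaussian βd) i).quasiMeasurePreserving.ae
      (ae_complexGaussian_ne_zero hβd.ne')
  rw [← hd] at h1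
  exact ae_of_ae_map hm.aemeasurable h1

/-- The rate achieved on a scalar channel of gain `u` with total distortion level `c`. -/
def scalarRate (c σu p u : ℝ) : ℝ :=
  Real.logb 2 (1 + u * p / (c * (u * p) + σu ^ 2))

lemma measurable_scalarRate (c σu p : ℝ) : Measurable (scalarRate c σu p) := by
  unfold scalarRate Real.logb; fun_prop

lemma scalarRate_le {c σu p u : ℝ} (hc : 0 < c) (hσu : 0 < σu) (hp : 0 ≤ p) (hu : 0 ≤ u) :
    scalarRate c σu p u ≤ Real.logb 2 (1 + 1 / c) := by
  unfold scalarRate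
  gcongr 1
  · norm_num
  · gcongr 1
    rw [div_le_div_iff₀ (by positivity) hc]
    nlinarith [sq_nonneg σu]

lemma tendsto_scalarRate {c σu u : ℝ} (hc : 0 < c) (hu : 0 < u) :
    Tendsto (fun p => scalarRate c σu p u) atTop (𝓝 (Real.logb 2 (1 + 1 / c))) := by
  have h : Tendsto (fun p : ℝ => 1 + 1 / (c + σu ^ 2 / (u * p))) atTop (𝓝 (1 + 1 / c)) := by
    have h0 : Tendsto (fun p : ℝ => σu ^ 2 / (u * p)) atTop (𝓝 0) :=
      (tendsto_id.const_mul_atTop hu).const_div_atTop _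
    have h1 := (h0.const_add c)
    rw [add_zero] at h1
    exact (tendsto_const_nhds.div h1 hc.ne').const_add 1
  have h2 := (Real.continuousAt_logb (b := 2) (x := 1 + 1 / c) (by positivity)).tendsto.comp h
  refine h2.congr' ?_
  filter_upwards [eventually_gt_atTop 0] with p hp
  simp only [scalarRate, Function.comp]
  congr 2
  field_simp

/-- The uniform distribution of a phase in `[0, 2π]`. -/
def phaseLaw : Measure ℝ := ProbabilityTheory.cond volume (Set.Icc 0 (2 * Real.pi))

instance instIsProbabilityMeasurePhaseLaw : IsProbabilityMeasure phaseLaw := by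
  refine cond_isProbabilityMeasure_of_finite ?_ ?_
  · simp [Real.pi_pos]
  · rw [Real.volume_Icc]
    exact ENNReal.ofReal_ne_top

lemma ae_phaseLaw_mem : ∀ᵐ t ∂phaseLaw, t ∈ Set.Icc 0 (2 * Real.pi) :=
  ae_cond_mem measurableSet_Icc

/-- Any two zeros t differ by a multiple of 2π, so the zero set is countable, hence null. -/
lemma ae_phaseLaw_add_exp_mul_ne_zero {a : ℂ} (ha : a ≠ 0) (c : ℂ) :
    ∀ᵐ t : ℝ ∂phaseLaw, a + Complex.exp (Complex.I * (t : ℂ)) * c ≠ 0 := by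
  have hcount : {t : ℝ | a + Complex.exp (Complex.I * (t : ℂ)) * c = 0}.Countable := by
    rcases Set.eq_empty_or_nonempty {t : ℝ | a + Complex.exp (Complex.I * (t : ℂ)) * c = 0} with
      h | ⟨t₀, ht₀⟩
    · simp [h]
    · refine (Set.countable_range fun n : ℤ => t₀ + n * (2 * Real.pi)).mono fun t ht => ?_
      have hc : c ≠ 0 := by
        rintro rfl
        simp [ha] at ht
      have he : Complex.exp (Complex.I * (t : ℂ)) = Complex.exp (Complex.I * (t₀ : ℂ)) :=
        mul_right_cancel₀ hc (add_left_cancel (ht.trans ht₀.symm))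
      obtain ⟨n, hn⟩ := Complex.exp_eq_exp_iff_exists_int.1 he
      refine ⟨n, ?_⟩
      have h : Complex.I * (t : ℂ) = Complex.I * ((t₀ + n * (2 * Real.pi) : ℝ) : ℂ) := by
        rw [hn]; push_cast; ring
      exact_mod_cast (mul_left_cancel₀ Complex.I_ne_zero h).symm
  have h0 : phaseLaw {t : ℝ | a + Complex.exp (Complex.I * (t : ℂ)) * c = 0} = 0 :=
    cond_absolutelyContinuous (hcount.measure_zero _)
  exact measure_eq_zero_iff_ae_notMem.1 h0

/-- With a common phase `t` at all reflecting elements, the overall channel is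
`h_d + exp (j t) G h_r'`. -/
lemma overallChannel_const {M N : ℕ} (s : ChannelState M N) (t : ℝ) (i : Fin M) :
    overallChannel s (fun _ => t) i = s.1 i + Complex.exp (Complex.I * (t : ℂ)) *
      ∑ n, s.2.1 i n * (Complex.exp (Complex.I * (s.2.2.2 n : ℂ)) * s.2.2.1 n) := by
  simp only [overallChannel, Pi.add_apply, Matrix.mulVec, dotProduct, Matrix.of_apply,
    Matrix.diagonal_apply, Finset.mul_sum]
  congr 1
  refine Finset.sum_congr rfl fun n _ => ?_
  simp [mul_add, Complex.exp_add]
  ring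

lemma measurable_overallChannel_const {M N : ℕ} (i : Fin M) :
    Measurable (fun w : ChannelState M N × ℝ => overallChannel w.1 (fun _ => w.2) i) := by
  simp_rw [overallChannel_const]
  fun_prop

/-- A prescribed phase would not do: under an arbitrary joint law the reflected path may equal minus
the direct one there. Randomising the phase needs only that the direct gain is almost surely
nonzero. -/
lemma ae_overallChannel_ne_zero {M N : ℕ} {Ω : Type*} [MeasurableSpace Ω] {P : Measure Ω}
    {H : Ω → ChannelState M N} (hH : Measurable H) {βd : ℝ≥0} (hβd : 0 < βd)
    (hd : P.map (fun ω => (H ω).1) = complexGaussianVec (fun _ => βd)) (i : Fin M) :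
    ∀ᵐ w ∂(P.prod phaseLaw), overallChannel (H w.1) (fun _ => w.2) i ≠ 0 := by
  have hm : Measurable (fun w : Ω × ℝ => overallChannel (H w.1) (fun _ => w.2) i) :=
    (measurable_overallChannel_const i).comp
      ((hH.comp measurable_fst).prodMk measurable_snd)
  rw [Measure.ae_prod_iff_ae_ae
    (p := fun w : Ω × ℝ => overallChannel (H w.1) (fun _ => w.2) i ≠ 0)
    (hm (measurableSet_singleton 0).compl)]
  filter_upwards [ae_direct_ne_zero hH hβd hd i] with ω hω
  filter_upwards [ae_phaseLaw_add_exp_mul_ne_zero hω _] with t ht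
  simpa only [overallChannel_const] using ht

/-! ### Monotonicity of the capacity and its two bounds. -/

section Capacity

variable {M N : ℕ} {Ω 𝓑 𝓤 : Type*} [MeasurableSpace Ω] [MeasurableSpace 𝓑]
  [MeasurableSpace 𝓤] [StandardBorelSpace 𝓤] [Nonempty 𝓤]
  {P : Measure Ω} [IsProbabilityMeasure P]
  {H : Ω → ChannelState M N} {Hb : Ω → 𝓑} {Hu : Ω → 𝓤}
  {τd τ κb κu σu : ℝ}

/-- Amplification by √(q/p) carries inputs of power p to inputs of power q and helps for every
channel state separately, so it survives averaging over the CSI with the phases unchanged. -/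
lemma capacity_mono (hκb : 0 ≤ κb) (hκu : 0 ≤ κu) (hσu : 0 < σu) {p q : ℝ} (hp : 0 < p)
    (hpq : p ≤ q) :
    capacity P H Hb Hu τd τ κb κu σu p ≤ capacity P H Hb Hu τd τ κb κu σu q := by
  unfold capacity
  refine mul_le_mul' le_rfl (lintegral_mono fun b => ?_)
  refine iSup₂_mono fun θ _ => ?_
  refine iSup₂_le fun μ hμ => ?_
  have := hμ.1
  have hr : 1 ≤ √(q / p) := Real.one_le_sqrt.2 ((one_le_div hp).2 hpq)
  have hq : IsInputLaw q (μ.map (fun x => √(q / p) • x)) := by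
    have h := hμ.map_smul (√(q / p))
    rwa [Real.sq_sqrt (div_nonneg (hp.le.trans hpq) hp.le), div_mul_cancel₀ _ hp.ne'] at h
  refine le_iSup₂_of_le _ hq (lintegral_mono fun s => ?_)
  exact mutualInfo_le_map_smul hμ.integrable_norm_sq hκb hκu hσu _ hr

lemma capacity_le (hM : 1 ≤ M) (hHb : Measurable Hb) (hτ : 0 ≤ τd / τ)
    (hκb : 0 ≤ κb) (hκu : 0 ≤ κu) (hκ : 0 < κb + κu) (hσu : 0 < σu) (p : ℝ) :
    capacity P H Hb Hu τd τ κb κu σu p ≤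
      ENNReal.ofReal (τd / τ * Real.logb 2 (1 + (M : ℝ) / (κb + κu * ((M : ℝ) + κb)))) := by
  have := Measure.isProbabilityMeasure_map (μ := P) hHb.aemeasurable
  rw [capacity, ENNReal.ofReal_mul hτ]
  gcongr
  set B := ENNReal.ofReal (Real.logb 2 (1 + (M : ℝ) / (κb + κu * ((M : ℝ) + κb))))
  refine le_trans (lintegral_mono (g := fun _ => B) fun b => ?_) (by simp)
  refine iSup_le fun θ => iSup_le fun _ => iSup_le fun μ => iSup_le fun hμ => ?_
  refine le_trans (lintegral_mono (g := fun _ => B) fun s => ?_) (by simp)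
  exact mutualInfo_inputOutputLaw_le_of_power hM hμ hκb hκu hκ hσu _

/-- For each realization of the CSI the supremum dominates every admissible common phase, hence
their uniform average; no phase has to be selected measurably. -/
lemma lintegral_scalarRate_le_capacity (hH : Measurable H) (hHb : Measurable Hb)
    (hHu : Measurable Hu) (hκb : 0 ≤ κb) (hκu : 0 ≤ κu) (hσu : 0 < σu) (i : Fin M)
    {p : ℝ} (hp : 0 ≤ p) :
    ENNReal.ofReal (τd / τ) * ∫⁻ w, ENNReal.ofReal (scalarRate (κb + κu * (1 + κb)) σu p
        (‖overallChannel (H w.1) (fun _ => w.2) i‖ ^ 2)) ∂(P.prod phaseLaw) ≤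
      capacity P H Hb Hu τd τ κb κu σu p := by
  set R : ChannelState M N → ℝ → ℝ≥0∞ := fun s t =>
    ENNReal.ofReal (scalarRate (κb + κu * (1 + κb)) σu p
      (‖overallChannel s (fun _ => t) i‖ ^ 2)) with hR
  have hRm : Measurable (Function.uncurry R) :=
    ((measurable_scalarRate _ _ _).comp
      ((measurable_overallChannel_const i).norm.pow_const 2)).ennreal_ofReal
  have hHHu : Measurable (fun ω => (H ω, Hu ω)) := hH.prodMk hHu
  have hprob := Measure.isProbabilityMeasure_map (μ := P) hHb.aemeasurable
  have hRs : Measurable (fun s : ChannelState M N × 𝓤 => ∫⁻ t, R s.1 t ∂phaseLaw) :=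
    (hRm.lintegral_prod_right' (ν := phaseLaw)).comp measurable_fst
  -- Tonelli exchanges phase and channel; averaging the conditional law over `Hb` gives back the law
  -- of `(H, Hu)`.
  have hFub : ∫⁻ w, R (H w.1) w.2 ∂(P.prod phaseLaw) =
      ∫⁻ b, ∫⁻ t, ∫⁻ s, R s.1 t ∂(condDistrib (fun ω => (H ω, Hu ω)) Hb P b) ∂phaseLaw
        ∂(P.map Hb) := by
    have h1 : ∀ b, ∫⁻ t, ∫⁻ s, R s.1 t ∂(condDistrib (fun ω => (H ω, Hu ω)) Hb P b) ∂phaseLaw =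
        ∫⁻ s, ∫⁻ t, R s.1 t ∂phaseLaw ∂(condDistrib (fun ω => (H ω, Hu ω)) Hb P b) := by
      intro b
      rw [lintegral_lintegral_swap]
      exact (hRm.comp ((measurable_fst.comp measurable_snd).prodMk measurable_fst)).aemeasurable
    simp_rw [h1]
    rw [← Measure.lintegral_bind (Kernel.aemeasurable _) hRs.aemeasurable,
      condDistrib_comp_map hHb.aemeasurable hHHu.aemeasurable, lintegral_map hRs hHHu,
      lintegral_prod]
    exact (hRm.comp ((hH.comp measurable_fst).prodMk measurable_snd)).aemeasurable
  rw [capacity]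
  gcongr
  change ∫⁻ w, R (H w.1) w.2 ∂(P.prod phaseLaw) ≤ _
  rw [hFub]
  refine lintegral_mono fun b => ?_
  set S := ⨆ (θ : Fin N → ℝ) (_ : ∀ n, θ n ∈ Set.Icc 0 (2 * Real.pi))
        (μ : Measure (Fin M → ℂ)) (_ : IsInputLaw p μ),
        ∫⁻ s, mutualInfo (inputOutputLaw κb κu σu (overallChannel s.1 θ) μ)
          ∂(condDistrib (fun ω => (H ω, Hu ω)) Hb P b)
  have hS : ∀ᵐ t ∂phaseLaw,
      ∫⁻ s, R s.1 t ∂(condDistrib (fun ω => (H ω, Hu ω)) Hb P b) ≤ S := by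
    filter_upwards [ae_phaseLaw_mem] with t ht
    have hlaw : IsInputLaw p (singleAntennaLaw i p.toNNReal) := by
      have h := isInputLaw_singleAntennaLaw i p.toNNReal
      rwa [Real.coe_toNNReal _ hp] at h
    refine le_iSup₂_of_le (fun _ => t) (fun _ => ht) (le_iSup₂_of_le _ hlaw ?_)
    refine lintegral_mono fun s => ?_
    rw [mutualInfo_singleAntennaLaw i _ hκb hκu hσu, Real.coe_toNNReal _ hp]
    exact le_rfl
  calc _ ≤ ∫⁻ _, S ∂phaseLaw := lintegral_mono_ae hS
    _ = S := by simp

/-- The limiting rate itself is a constant dominating bound, so almost everywhere convergence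
suffices. -/
lemma tendsto_lintegral_scalarRate (hH : Measurable H) {βd : ℝ≥0} (hβd : 0 < βd)
    (hd : P.map (fun ω => (H ω).1) = complexGaussianVec (fun _ => βd)) {c : ℝ} (hc : 0 < c)
    (hσu : 0 < σu) (i : Fin M) :
    Tendsto (fun p => ∫⁻ w, ENNReal.ofReal (scalarRate c σu p
        (‖overallChannel (H w.1) (fun _ => w.2) i‖ ^ 2)) ∂(P.prod phaseLaw)) atTop
      (𝓝 (ENNReal.ofReal (Real.logb 2 (1 + 1 / c)))) := by
  have hlim : ENNReal.ofReal (Real.logb 2 (1 + 1 / c)) =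
      ∫⁻ _, ENNReal.ofReal (Real.logb 2 (1 + 1 / c)) ∂(P.prod phaseLaw) := by simp
  rw [hlim]
  refine tendsto_lintegral_filter_of_dominated_convergence
    (fun _ => ENNReal.ofReal (Real.logb 2 (1 + 1 / c))) ?_ ?_ (by simp) ?_
  · refine Eventually.of_forall fun p => ?_
    exact ((measurable_scalarRate _ _ _).comp (((measurable_overallChannel_const i).comp
      ((hH.comp measurable_fst).prodMk measurable_snd)).norm.pow_const 2)).ennreal_ofReal
  · filter_upwards [eventually_ge_atTop 0] with p hp
    exact ae_of_all _ fun w => ENNReal.ofReal_le_ofReal (scalarRate_le hc hσu hp (sq_nonneg _))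
  · filter_upwards [ae_overallChannel_ne_zero hH hβd hd i] with w hw
    exact ENNReal.tendsto_ofReal (tendsto_scalarRate hc (by positivity))

end Capacity

end IRSDownlink

end

/-! ### Assembly of the limit and its bounds. -/

theorem theorem3 {M N : ℕ} (hM : 1 ≤ M)
    {Ω 𝓑 𝓤 : Type*} [MeasurableSpace Ω] [MeasurableSpace 𝓑]
    [MeasurableSpace 𝓤] [StandardBorelSpace 𝓤] [Nonempty 𝓤]
    (P : Measure Ω) [IsProbabilityMeasure P]
    (H : Ω → IRSDownlink.ChannelState M N) (hH : Measurable H)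
    (Hb : Ω → 𝓑) (hHb : Measurable Hb) (Hu : Ω → 𝓤) (hHu : Measurable Hu)
    (βd : ℝ≥0) (hβd : 0 < βd)
    (hd : P.map (fun ω => (H ω).1) = IRSDownlink.complexGaussianVec (fun _ => βd))
    (τd τ κb κu σu : ℝ) (hτd : 0 ≤ τd) (hτ : 0 < τ)
    (hκb : 0 ≤ κb) (hκu : 0 ≤ κu) (hκ : 0 < κb + κu) (hσu : 0 < σu) :
    ∃ L : ℝ,
      Tendsto (fun p : ℝ => IRSDownlink.capacity P H Hb Hu τd τ κb κu σu p) atTop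
        (𝓝 (ENNReal.ofReal L)) ∧
      τd / τ * Real.logb 2 (1 + 1 / (κb + κu * (1 + κb))) ≤ L ∧
      L ≤ τd / τ * Real.logb 2 (1 + (M : ℝ) / (κb + κu * ((M : ℝ) + κb))) := by
  have hτd' : 0 ≤ τd / τ := by positivity
  have hc : 0 < κb + κu * (1 + κb) := by nlinarith [mul_nonneg hκu hκb]
  set C := fun p : ℝ => IRSDownlink.capacity P H Hb Hu τd τ κb κu σu p with hC
  -- Monotonicity is available only from positive powers; truncating at 1 gives a globally monotone
  -- function that agrees with `C` eventually.
  have hmono : Monotone fun p : ℝ => C (max p 1) := fun p q hpq =>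
    IRSDownlink.capacity_mono hκb hκu hσu (by positivity) (max_le_max_right 1 hpq)
  have hlim : Tendsto C atTop (𝓝 (⨆ p : ℝ, C (max p 1))) := by
    refine (tendsto_atTop_iSup hmono).congr' ?_
    filter_upwards [eventually_ge_atTop 1] with p hp
    rw [max_eq_left hp]
  have hle : ⨆ p : ℝ, C (max p 1) ≤
      ENNReal.ofReal (τd / τ * Real.logb 2 (1 + (M : ℝ) / (κb + κu * ((M : ℝ) + κb)))) :=
    iSup_le fun p => IRSDownlink.capacity_le hM hHb hτd' hκb hκu hκ hσu _
  have hge : ENNReal.ofReal (τd / τ * Real.logb 2 (1 + 1 / (κb + κu * (1 + κb)))) ≤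
      ⨆ p : ℝ, C (max p 1) := by
    rw [ENNReal.ofReal_mul hτd']
    -- Any antenna would serve for the lower bound; M ≥ 1 provides index 0.
    refine le_of_tendsto_of_tendsto
      (ENNReal.Tendsto.const_mul (IRSDownlink.tendsto_lintegral_scalarRate hH hβd hd hc hσu
        (⟨0, hM⟩ : Fin M)) (Or.inr ENNReal.ofReal_ne_top)) hlim ?_
    filter_upwards [eventually_ge_atTop 0] with p hp
    exact IRSDownlink.lintegral_scalarRate_le_capacity hH hHb hHu hκb hκu hσu _ hp
  have htop : ⨆ p : ℝ, C (max p 1) ≠ ∞ := ne_top_of_le_ne_top ENNReal.ofReal_ne_top hle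
  have hU : 0 ≤ τd / τ * Real.logb 2 (1 + (M : ℝ) / (κb + κu * ((M : ℝ) + κb))) := by
    refine mul_nonneg hτd' (Real.logb_nonneg one_lt_two ?_)
    have : 0 ≤ (M : ℝ) / (κb + κu * ((M : ℝ) + κb)) := by positivity
    linarith
  refine ⟨(⨆ p : ℝ, C (max p 1)).toReal, ?_, ?_, ?_⟩
  · rwa [ENNReal.ofReal_toReal htop]
  · exact (ENNReal.ofReal_le_iff_le_toReal htop).1 hge
  · exact ENNReal.toReal_le_of_le_ofReal hU hle
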